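/- Conventions. A map on $[t_0,t_1]$ ($t_0<t_1$) is piecewise-$C^2$ when it is $C^1$ on $[t_0,t_1]$ and is $C^2$, up to endpoints, on each of the finitely many closed intervals of some subdivision of $[t_0,t_1]$. Second derivatives at points of the subdivision are understood as one-sided limits, from the left or from the right, and an assertion "at $t$" about a pair of such quantities refers to limits from the same side. Let $M$ be a $C^\infty$ manifold of finite dimension with a $C^\infty$ Riemannian metric $\langle\ ,\ \rangle$, Levi-Civita covariant derivative $\nabla$, and Riemannian curvature $R(X,Y)Z=\nabla_X\nabla_YZ-\nabla_Y\nabla_XZ-\nabla_{[X,Y]}Z$. Let $t_0<t_1$, $x_0,x_1\in M$, $v_i\in T_{x_i}M$, and let $x:[t_0,t_1]\to M$ be a feasible curve, that is, a piecewise-$C^2$ curve with $x(t_i)=x_i$ and $x^{(1)}(t_i)=v_i$ for $i=0,1$. For a piecewise-$C^2$ field $X$ along $x$ put $$L(X):=\nabla_t^2X+R(X,x^{(1)})x^{(1)},$$ and put $J(x):=\max_{t\in[t_0,t_1]}\Vert\nabla_tx^{(1)}(t)\Vert$ and $S_x:=\{s\in[t_0,t_1]:\Vert\nabla_tx^{(1)}(s)\Vert=J(x)\}$.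 Suppose that $\Vert\nabla_tx^{(1)}\Vert$ is constant on $[t_0,t_1]$ and that there is a piecewise-$C^2$ function $\Phi:[t_0,t_1]\to[0,\infty)$ with $\Phi^{-1}(0)$ discrete such that, with $\phi:=\sqrt\Phi$, the field $\phi\nabla_tx^{(1)}$ is piecewise-$C^2$ and $$L(\phi\nabla_tx^{(1)})=\mathbf 0\quad\text{on }[t_0,t_1],$$ and such that $x$ and $\phi$ are $C^\infty$ except possibly where $\Phi=0$. Then $x$ is an $L^\infty$-extremal: for every variational field $W$ along $x$, that is, every piecewise-$C^2$ field $W$ along $x$ with $W(t_i)=\nabla_tW\vert_{t=t_i}=\mathbf 0$ for $i=0,1$, there is $s_W\in S_x$ with $$\langle L(W),\nabla_tx^{(1)}\rangle_{t=s_W}\ge 0.$$ -/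

import Mathlib

open scoped Manifold ContDiff Bundle

noncomputable section

namespace MinAccel

/-- The model space `ℝᵐ` of an `m`-dimensional manifold. -/
abbrev E (m : ℕ) : Type := EuclideanSpace ℝ (Fin m)

/-- A `C^∞` Riemannian metric on the `m`-manifold `M`. -/
abbrev Metric (m : ℕ) (M : Type*) [TopologicalSpace M] [ChartedSpace (E m) M]
    [IsManifold (𝓡 m) ∞ M] : Type _ :=
  Bundle.ContMDiffRiemannianMetric (𝓡 m) ∞ (E m) (fun q : M => TangentSpace (𝓡 m) q)

/-- A map `f` on `[t₀, t₁]` with values in a manifold is piecewise-`C²`: it is `C¹` on `[t₀, t₁]`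
and, for some finite set `P` of break points, it is `C²` (up to the end points) on every closed
subinterval that has no break point in its interior. -/
def IsPiecewiseC2 {F : Type*} [NormedAddCommGroup F] [NormedSpace ℝ F] {H : Type*}
    [TopologicalSpace H] (I : ModelWithCorners ℝ F H) {N : Type*} [TopologicalSpace N]
    [ChartedSpace H N] (t₀ t₁ : ℝ) (f : ℝ → N) : Prop :=
  ContMDiffOn 𝓘(ℝ, ℝ) I 1 f (Set.Icc t₀ t₁) ∧
    ∃ P : Finset ℝ, ∀ a b : ℝ, a < b → Set.Icc a b ⊆ Set.Icc t₀ t₁ →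
      Disjoint (Set.Ioo a b) (P : Set ℝ) → ContMDiffOn 𝓘(ℝ, ℝ) I 2 f (Set.Icc a b)

/-- A piecewise-continuous field on `[t₀, t₁]` has at `t` a limit from the left (if `t₀ < t`) and
a limit from the right (if `t < t₁`), which can differ at a break point. -/
inductive Side : Type
  | left
  | right

/-- The part of `[t₀, t₁]` on the given side of `t`. -/
def Side.interval (σ : Side) (t₀ t₁ t : ℝ) : Set ℝ :=
  match σ with
  | .left => Set.Icc t₀ t
  | .right => Set.Icc t t₁

/-- `t` is a point of `[t₀, t₁]` and `[t₀, t₁]` extends beyond `t` on the side `σ`. -/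
def Side.Admissible (σ : Side) (t₀ t₁ t : ℝ) : Prop :=
  t ∈ Set.Icc t₀ t₁ ∧
    match σ with
    | .left => t₀ < t
    | .right => t < t₁

section Geometry

variable {m : ℕ} {M : Type*} [TopologicalSpace M] [ChartedSpace (E m) M]

/-- The coordinates of a tangent vector at `q` in the preferred chart around `p`. -/
def coord (p q : M) : TangentSpace (𝓡 m) q →L[ℝ] E m :=
  mfderiv (𝓡 m) 𝓘(ℝ, E m) (extChartAt (𝓡 m) p) q

/-- The tangent vector at `q` with given coordinates in the preferred chart around `p`. -/
def ofCoord (p q : M) : E m →L[ℝ] TangentSpace (𝓡 m) q :=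
  (coord p q).inverse

/-- The standard basis of `ℝᵐ`. -/
def e (i : Fin m) : E m := EuclideanSpace.single i 1

variable [IsManifold (𝓡 m) ∞ M] (g : Metric m M)

/-- The Riemannian norm `‖v‖_q`. -/
def rnorm (q : M) (v : TangentSpace (𝓡 m) q) : ℝ := √(g.inner q v v)

/-- The matrix `g_{ij}` of the metric in the preferred chart around `p`, as a function of the
coordinates `u ∈ ℝᵐ`. -/
def gram (p : M) (u : E m) : Matrix (Fin m) (Fin m) ℝ :=
  let q : M := (extChartAt (𝓡 m) p).symm u
  Matrix.of fun i j => g.inner q (ofCoord p q (e i)) (ofCoord p q (e j))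

/-- `∂g_{ij}/∂x_k` in the preferred chart around `p`. -/
def dgram (p : M) (u : E m) (k i j : Fin m) : ℝ :=
  fderiv ℝ (fun u' : E m => gram g p u' i j) u (e k)

/-- The Christoffel symbols `Γᵏ_{ij}` of the Levi-Civita connection in the preferred chart
around `p`. -/
def christoffel (p : M) (u : E m) (k i j : Fin m) : ℝ :=
  (1 / 2) * ∑ l, (gram g p u)⁻¹ k l * (dgram g p u i j l + dgram g p u j i l - dgram g p u l i j)

/-- The bilinear map `Γ(Y, W) = Γᵏ_{ij} Yⁱ Wʲ e_k`. -/
def Gam (p : M) (u Y W : E m) : E m :=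
  WithLp.toLp 2 fun k => ∑ i, ∑ j, christoffel g p u k i j * Y i * W j

/-- The Riemannian curvature `R(X, Y)Z` in the preferred chart around `p`:
`(∂ₖΓⁱ_{pj} - ∂ₚΓⁱ_{kj} + Γⁱ_{kq} Γ^q_{pj} - Γⁱ_{pq} Γ^q_{kj}) Xᵏ Yᵖ Zʲ e_i`. -/
def curvCoord (p : M) (u X Y Z : E m) : E m :=
  fderiv ℝ (fun u' : E m => Gam g p u' Y Z) u X - fderiv ℝ (fun u' : E m => Gam g p u' X Z) u Y
    + Gam g p u X (Gam g p u Y Z) - Gam g p u Y (Gam g p u X Z)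

/-- The Riemannian curvature `R(X, Y)Z` at `q`, computed in the preferred chart around `q`. -/
def curv (q : M) (X Y Z : TangentSpace (𝓡 m) q) : TangentSpace (𝓡 m) q :=
  ofCoord q q
    (curvCoord g q (extChartAt (𝓡 m) q q) (coord q q X) (coord q q Y) (coord q q Z))

variable (t₀ t₁ : ℝ) (x : ℝ → M)

/-- The velocity `x⁽¹⁾(t)` of a curve `x` on `[t₀, t₁]` (one-sided at `t₀` and `t₁`). -/
def velocity (t : ℝ) : TangentSpace (𝓡 m) (x t) :=
  mfderivWithin 𝓘(ℝ, ℝ) (𝓡 m) x (Set.Icc t₀ t₁) t (1 : ℝ)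

/-- The Levi-Civita covariant derivative at time `t`, with respect to `t ∈ S`, of a field `V`
along `x`: in coordinates `dV/dt + Γ(x⁽¹⁾, V)`, computed in the preferred chart around `x t`.
The set `S` is `[t₀, t₁]`, or its part on one side of `t` for one-sided derivatives. -/
def covDeriv (S : Set ℝ) (V : (t : ℝ) → TangentSpace (𝓡 m) (x t)) (t : ℝ) :
    TangentSpace (𝓡 m) (x t) :=
  ofCoord (x t) (x t)
    (derivWithin (fun s => coord (x t) (x s) (V s)) S t
      + Gam g (x t) (extChartAt (𝓡 m) (x t) (x t))
          (coord (x t) (x t) (velocity t₀ t₁ x t)) (coord (x t) (x t) (V t)))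

/-- The covariant acceleration `∇ₜ x⁽¹⁾` at `t`, on the side `σ` of `t`. -/
def accel (σ : Side) (t : ℝ) : TangentSpace (𝓡 m) (x t) :=
  covDeriv g t₀ t₁ x (σ.interval t₀ t₁ t) (velocity t₀ t₁ x) t

/-- `L(V) = ∇ₜ² V + R(V, x⁽¹⁾) x⁽¹⁾` at `t`, on the side `σ` of `t`. -/
def opL (V : (t : ℝ) → TangentSpace (𝓡 m) (x t)) (σ : Side) (t : ℝ) :
    TangentSpace (𝓡 m) (x t) :=
  covDeriv g t₀ t₁ x (σ.interval t₀ t₁ t) (covDeriv g t₀ t₁ x (Set.Icc t₀ t₁) V) t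
    + curv g (x t) (V t) (velocity t₀ t₁ x t) (velocity t₀ t₁ x t)

/-- `J(x)`, the maximum of the norm of the covariant acceleration over `[t₀, t₁]`. -/
def J : ℝ :=
  sSup {r : ℝ | ∃ (t : ℝ) (σ : Side), σ.Admissible t₀ t₁ t ∧
    r = rnorm g (x t) (accel g t₀ t₁ x σ t)}

/-- `V` is a piecewise-`C²` field along `x`. -/
def IsPiecewiseC2Field (V : (t : ℝ) → TangentSpace (𝓡 m) (x t)) : Prop :=
  IsPiecewiseC2 (𝓡 m).tangent t₀ t₁ (fun t => (⟨x t, V t⟩ : TangentBundle (𝓡 m) M))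

/-- `x` is a feasible curve: a piecewise-`C²` curve on `[t₀, t₁]` with `x(tᵢ) = xᵢ` and
`x⁽¹⁾(tᵢ) = vᵢ` for `i = 0, 1`. -/
structure IsFeasible {x₀ x₁ : M} (v₀ : TangentSpace (𝓡 m) x₀) (v₁ : TangentSpace (𝓡 m) x₁) :
    Prop where
  piecewiseC2 : IsPiecewiseC2 (𝓡 m) t₀ t₁ x
  init : (⟨x t₀, velocity t₀ t₁ x t₀⟩ : TangentBundle (𝓡 m) M) = ⟨x₀, v₀⟩
  final : (⟨x t₁, velocity t₀ t₁ x t₁⟩ : TangentBundle (𝓡 m) M) = ⟨x₁, v₁⟩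

/-- `W` is a variational field along `x`. -/
structure IsVariational (W : (t : ℝ) → TangentSpace (𝓡 m) (x t)) : Prop where
  piecewiseC2 : IsPiecewiseC2Field t₀ t₁ x W
  init : W t₀ = 0
  final : W t₁ = 0
  init_deriv : covDeriv g t₀ t₁ x (Set.Icc t₀ t₁) W t₀ = 0
  final_deriv : covDeriv g t₀ t₁ x (Set.Icc t₀ t₁) W t₁ = 0

/-- `x` is an `L^∞`-extremal: for every variational field `W` along `x`, `⟨L(W), ∇ₜ x⁽¹⁾⟩ ≥ 0` at
some `s ∈ [t₀, t₁]` where the norm of the covariant acceleration attains its maximum `J(x)`. At a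
break point `s`, both are understood for the limits of `∇ₜ x⁽¹⁾` and `L(W)` from the same side. -/
def IsLinftyExtremal : Prop :=
  ∀ W : (t : ℝ) → TangentSpace (𝓡 m) (x t), IsVariational g t₀ t₁ x W →
    ∃ (s : ℝ) (σ : Side), σ.Admissible t₀ t₁ s ∧
      rnorm g (x s) (accel g t₀ t₁ x σ s) = J g t₀ t₁ x ∧
      0 ≤ g.inner (x s) (opL g t₀ t₁ x W σ s) (accel g t₀ t₁ x σ s)

/-- The necessary condition for optimality: `‖∇ₜ x⁽¹⁾‖` is constant and, for some piecewise-`C²`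
function `Φ : [t₀, t₁] → [0, ∞)` with discrete zero set and `φ = √Φ`, the field `X = φ ∇ₜ x⁽¹⁾` is
piecewise-`C²` with `L(X) = 0`, and `x` and `φ` are `C^∞` except possibly where `Φ` vanishes. -/
def NecessaryCondition : Prop :=
  (∃ z : ℝ, ∀ (t : ℝ) (σ : Side), σ.Admissible t₀ t₁ t →
      rnorm g (x t) (accel g t₀ t₁ x σ t) = z) ∧
  ∃ Φ : ℝ → ℝ,
    IsPiecewiseC2 𝓘(ℝ, ℝ) t₀ t₁ Φ ∧
    (∀ t ∈ Set.Icc t₀ t₁, 0 ≤ Φ t) ∧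
    DiscreteTopology {t : ℝ // t ∈ Set.Icc t₀ t₁ ∧ Φ t = 0} ∧
    (∃ X : (t : ℝ) → TangentSpace (𝓡 m) (x t),
      IsPiecewiseC2Field t₀ t₁ x X ∧
      ∀ (t : ℝ) (σ : Side), σ.Admissible t₀ t₁ t →
        X t = √(Φ t) • accel g t₀ t₁ x σ t ∧ opL g t₀ t₁ x X σ t = 0) ∧
    ∀ t ∈ Set.Icc t₀ t₁, Φ t ≠ 0 →
      ContMDiffWithinAt 𝓘(ℝ, ℝ) (𝓡 m) ∞ x (Set.Icc t₀ t₁) t ∧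
      ContDiffWithinAt ℝ ∞ (fun s => √(Φ s)) (Set.Icc t₀ t₁) t

end Geometry

end MinAccel

end

/-! The argument is Green's identity for the formally self-adjoint operator L. For a variational
field W and X = φ∇ₜx⁽¹⁾ put F = ⟨∇ₜW, X⟩ - ⟨W, ∇ₜX⟩. The terms ⟨∇ₜW, ∇ₜX⟩ cancel in the derivative
and the Jacobi operator R(·, x⁽¹⁾)x⁽¹⁾ is self-adjoint, so F' = ⟨L(W), X⟩ - ⟨W, L(X)⟩ = φ⟨L(W),
∇ₜx⁽¹⁾⟩ (`hasDerivWithinAt_green`). As ‖∇ₜx⁽¹⁾‖ is constant, every point is a maximum point; if the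
conclusion failed, ⟨L(W), ∇ₜx⁽¹⁾⟩ would be negative everywhere and F' ≤ 0. But F vanishes at both
ends, hence F' = 0 throughout (`right_deriv_eq_zero`), which is impossible where φ > 0.

F is continuous and has a right derivative at every point of [t₀, t₁), break points included, so
one-sided calculus suffices and no integral is split.

Most of the work is to derive the geometry from the coordinate definitions: metric compatibility
(`dmetric_eq_Gam`), the symmetry of the curvature (`curvCoord_jacobi_symm`), and the transformation
law `fderiv_transition_Gam`. The last is needed because the covariant derivative at t is defined in
the chart around x t, which moves with t; a second derivative requires one fixed chart. -/

noncomputable section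

namespace MinAccel

/-! ### Pointwise algebra of a torsion-free metric connection and its curvature. -/

section LeviCivita

open Filter Topology

variable {V : Type*} [NormedAddCommGroup V] [NormedSpace ℝ V]

/-- A symmetric `Γ` compatible with the metric `B`, whose derivative is `D`, satisfies the Koszul
formula. -/
lemma koszul_of_compatible {B : V →L[ℝ] V →L[ℝ] ℝ} {D : V → V → V → ℝ}
    {Γ : V → V → V} (hB : ∀ X Y, B X Y = B Y X) (hΓ : ∀ X Y, Γ X Y = Γ Y X)
    (hD : ∀ Z X Y, D Z X Y = B (Γ Z X) Y + B X (Γ Z Y)) (Y W Z : V) :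
    B (Γ Y W) Z = (1 / 2) * (D Y W Z + D W Y Z - D Z Y W) := by
  rw [hD Y W Z, hD W Y Z, hD Z Y W, hΓ W Y, hΓ Z W, hΓ Z Y, hB (Γ Y Z) W]
  ring

/-- The coordinate expression of the curvature of a connection with Christoffel symbols `Γ`. -/
def curvOf (Γ : V → V → V → V) (u X Y Z : V) : V :=
  fderiv ℝ (fun u' => Γ u' Y Z) u X - fderiv ℝ (fun u' => Γ u' X Z) u Y
    + Γ u X (Γ u Y Z) - Γ u Y (Γ u X Z)

lemma curvOf_swap (Γ : V → V → V → V) (u X Y Z : V) : curvOf Γ u X Y Z = -curvOf Γ u Y X Z := by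
  simp only [curvOf]; abel

lemma curvOf_bianchi {Γ : V → V → V → V} {u : V}
    (hΓ : ∀ u X Y, Γ u X Y = Γ u Y X) (X Y Z : V) :
    curvOf Γ u X Y Z + curvOf Γ u Y Z X + curvOf Γ u Z X Y = 0 := by
  have h : ∀ X Y, (fun u' => Γ u' X Y) = fun u' => Γ u' Y X := fun X Y => by
    ext1 u'; exact hΓ u' X Y
  simp only [curvOf]
  rw [h Z Y, h Y X, h Z X, hΓ u Z Y, hΓ u Y X, hΓ u Z X]
  abel

/-- The curvature operators of a metric connection are antisymmetric. -/
lemma curvOf_antisymm {G : V → V →L[ℝ] V →L[ℝ] ℝ} {Γ : V → V → V → V} {u : V}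
    (hG : ContDiffAt ℝ 2 G u)
    (hD : ∀ᶠ u in 𝓝 u, ∀ Z X Y,
      fderiv ℝ (fun u => G u X Y) u Z = G u (Γ u Z X) Y + G u X (Γ u Z Y))
    (hΓ : ∀ X Y, DifferentiableAt ℝ (fun u' => Γ u' X Y) u) (Y Z A B : V) :
    G u (curvOf Γ u Y Z A) B + G u A (curvOf Γ u Y Z B) = 0 := by
  have hGd : DifferentiableAt ℝ G u := hG.differentiableAt (by norm_num)
  have hGc : ∀ A B, ContDiffAt ℝ 2 (fun u => G u A B) u := fun A B =>
    (hG.clm_apply contDiffAt_const).clm_apply contDiffAt_const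
  have hderiv : ∀ A B Y, fderiv ℝ G u Y A B = fderiv ℝ (fun u => G u A B) u Y := fun A B Y => by
    have h1 : HasFDerivAt (fun u => G u A B) _ u :=
      (hGd.hasFDerivAt.clm_apply (hasFDerivAt_const A u)).clm_apply (hasFDerivAt_const B u)
    rw [h1.fderiv]
    simp
  have hG' : DifferentiableAt ℝ (fderiv ℝ (fun u => G u A B)) u :=
    ((hGc A B).fderiv_right (m := 1) (by norm_num)).differentiableAt (by norm_num)
  have hD0 := hD.self_of_nhds
  -- Differentiate the compatibility identity once more. The mixed terms are symmetric in Y and Z,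
  -- so antisymmetrising leaves exactly the curvature terms, while the second derivative of G(A, B)
  -- drops out.
  have key : ∀ Y Z, fderiv ℝ (fderiv ℝ (fun u => G u A B)) u Y Z =
      G u (Γ u Y (Γ u Z A)) B + G u (Γ u Z A) (Γ u Y B) + G u (fderiv ℝ (fun u' => Γ u' Z A) u Y) B
      + (G u (Γ u Y A) (Γ u Z B) + G u A (Γ u Y (Γ u Z B))
        + G u A (fderiv ℝ (fun u' => Γ u' Z B) u Y)) := by
    intro Y Z
    have h1 : HasFDerivAt (fun v => fderiv ℝ (fun u => G u A B) v Z) _ u :=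
      hG'.hasFDerivAt.clm_apply (hasFDerivAt_const Z u)
    have h2 : HasFDerivAt (fun u => G u (Γ u Z A) B + G u A (Γ u Z B)) _ u :=
      ((hGd.hasFDerivAt.clm_apply (hΓ Z A).hasFDerivAt).clm_apply (hasFDerivAt_const B u)).add
        ((hGd.hasFDerivAt.clm_apply (hasFDerivAt_const A u)).clm_apply (hΓ Z B).hasFDerivAt)
    have h3 := h1.unique (h2.congr_of_eventuallyEq (hD.mono fun v hv => hv Z A B))
    have h4 := congrArg (fun f => f Y) h3
    simp only [_root_.add_apply, ContinuousLinearMap.comp_apply,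
      ContinuousLinearMap.flip_apply, _root_.zero_apply, map_zero, zero_add] at h4
    simp only [hderiv, hD0] at h4
    rw [h4]
    ring
  have h5 := key Y Z
  rw [(hGc A B).isSymmSndFDerivAt (by simp) Y Z, key Z Y] at h5
  simp only [curvOf, map_add, map_sub, _root_.add_apply,
    _root_.sub_apply]
  linarith

/-- The Jacobi operator `X ↦ R(X, T)T` of a Levi-Civita connection is self-adjoint. -/
lemma curvOf_jacobi_symm {G : V → V →L[ℝ] V →L[ℝ] ℝ} {Γ : V → V → V → V} {u : V}
    (hG : ContDiffAt ℝ 2 G u) (hs : ∀ X Y, G u X Y = G u Y X)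
    (hD : ∀ᶠ u in 𝓝 u, ∀ Z X Y,
      fderiv ℝ (fun u => G u X Y) u Z = G u (Γ u Z X) Y + G u X (Γ u Z Y))
    (hΓ : ∀ X Y, DifferentiableAt ℝ (fun u' => Γ u' X Y) u)
    (hΓs : ∀ u X Y, Γ u X Y = Γ u Y X) (X Y T : V) :
    G u (curvOf Γ u X T T) Y = G u X (curvOf Γ u Y T T) := by
  have a : ∀ Y Z A B, G u (curvOf Γ u Y Z A) B = -G u (curvOf Γ u Y Z B) A := fun Y Z A B => by
    have := curvOf_antisymm hG hD hΓ Y Z A B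
    rw [hs A] at this
    linarith
  have s : ∀ Y Z A B, G u (curvOf Γ u Y Z A) B = -G u (curvOf Γ u Z Y A) B := fun Y Z A B => by
    rw [curvOf_swap, map_neg, _root_.neg_apply]
  have b : ∀ X Y Z B, G u (curvOf Γ u X Y Z) B + G u (curvOf Γ u Y Z X) B
      + G u (curvOf Γ u Z X Y) B = 0 := fun X Y Z B => by
    have := congrArg (fun v => G u v B) (curvOf_bianchi (u := u) hΓs X Y Z)
    simpa using this
  -- A special case of pair symmetry: it follows linearly from three Bianchi identities and the
  -- antisymmetry in each pair of arguments.
  rw [hs X]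
  linarith [b X T Y T, b X Y T T, b X T T Y, a X T Y T, a X Y T T, a T X Y T, a T Y X T, s X T T Y,
    s Y T T X, s X T Y T, s Y T X T]

end LeviCivita

/-! ### The metric and its Christoffel symbols in one chart. -/

section Chart

open Filter Topology

variable {m : ℕ} {M : Type*} [TopologicalSpace M] [ChartedSpace (E m) M]

lemma sum_smul_e (A : E m) : ∑ i, A i • e i = A := by
  have := (EuclideanSpace.basisFun (Fin m) ℝ).sum_repr A
  simpa [e] using this

lemma isOpen_target (p : M) : IsOpen (extChartAt (𝓡 m) p).target := isOpen_extChartAt_target p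

lemma apply_eq_sum (f : E m →L[ℝ] ℝ) (Z : E m) : f Z = ∑ k, Z k * f (e k) := by
  conv_lhs => rw [← sum_smul_e Z]
  simp only [map_sum, map_smul, smul_eq_mul]

lemma apply_apply_eq_sum (B : E m →L[ℝ] E m →L[ℝ] ℝ) (X Y : E m) :
    B X Y = ∑ i, ∑ j, X i * Y j * B (e i) (e j) := by
  conv_lhs => rw [← sum_smul_e X]
  simp only [map_sum, map_smul, _root_.sum_apply, _root_.smul_apply, smul_eq_mul]
  refine Finset.sum_congr rfl fun i _ => ?_
  rw [apply_eq_sum (B (e i)), Finset.mul_sum]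
  exact Finset.sum_congr rfl fun j _ => by ring

variable [IsManifold (𝓡 m) ∞ M]

lemma isManifold_one : IsManifold (𝓡 m) 1 M := IsManifold.of_le (n := ∞) (by simp)

lemma isInvertible_coord {p q : M} (hq : q ∈ (extChartAt (𝓡 m) p).source) :
    (coord (m := m) p q).IsInvertible := by
  have := isManifold_one (m := m) (M := M)
  exact isInvertible_mfderiv_extChartAt hq

lemma ofCoord_coord {p q : M} (hq : q ∈ (extChartAt (𝓡 m) p).source)
    (v : TangentSpace (𝓡 m) q) : ofCoord p q (coord p q v) = v :=
  (isInvertible_coord hq).inverse_apply_self v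

lemma coord_ofCoord {p q : M} (hq : q ∈ (extChartAt (𝓡 m) p).source)
    (v : E m) : coord p q (ofCoord p q v) = v :=
  (isInvertible_coord hq).self_apply_inverse v

/-- Links coordinates defined through the derivative of the chart to the bundle trivialization,
through which smoothness of fields and of the metric is expressed. -/
lemma coord_eq_trivializationAt {p q : M} (hq : q ∈ (extChartAt (𝓡 m) p).source)
    (v : TangentSpace (𝓡 m) q) :
    coord p q v = (trivializationAt (E m) (TangentSpace (𝓡 m)) p ⟨q, v⟩).2 := by
  have := isManifold_one (m := m) (M := M)
  have hq' : q ∈ (chartAt (E m) p).source := by simpa using hq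
  rw [coord, ← TangentBundle.continuousLinearMapAt_trivializationAt hq',
    Bundle.Trivialization.continuousLinearMapAt_apply,
    Bundle.Trivialization.linearMapAt_apply, if_pos (by simpa using hq)]

lemma ofCoord_eq_trivializationAt {p q : M} (hq : q ∈ (extChartAt (𝓡 m) p).source) (v : E m) :
    ofCoord p q v = (trivializationAt (E m) (TangentSpace (𝓡 m)) p).symm q v := by
  rw [ofCoord, (isInvertible_coord hq).inverse_apply_eq, coord_eq_trivializationAt hq,
    Bundle.Trivialization.apply_mk_symm _ (by simpa using hq)]

lemma contMDiffOn_ofCoord (p : M) (A : E m) :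
    ContMDiffOn (𝓡 m) (𝓡 m).tangent ∞
      (fun q : M => (⟨q, ofCoord p q A⟩ : TangentBundle (𝓡 m) M)) (extChartAt (𝓡 m) p).source := by
  have h := (trivializationAt (E m) (TangentSpace (𝓡 m) (M := M)) p).contMDiffOn_symm
    (n := ∞) (IB := 𝓡 m)
  have h2 : ContMDiffOn (𝓡 m) ((𝓡 m).prod 𝓘(ℝ, E m)) ∞ (fun q : M => (q, A))
    (extChartAt (𝓡 m) p).source := contMDiffOn_id.prodMk contMDiffOn_const
  refine (h.comp h2 fun q hq => ?_).congr fun q hq => ?_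
  · simpa [Bundle.Trivialization.mem_target] using hq
  · rw [ofCoord_eq_trivializationAt hq]
    exact Bundle.Trivialization.mk_symm _ (by simpa using hq) A

variable (g : Metric m M)

/-- The metric in the preferred chart around `p`, as a field of bilinear forms on `ℝᵐ`. -/
def metricCoord (p : M) (u : E m) : E m →L[ℝ] E m →L[ℝ] ℝ :=
  ((ofCoord p ((extChartAt (𝓡 m) p).symm u)).precomp ℝ).comp
    ((g.inner ((extChartAt (𝓡 m) p).symm u)).comp (ofCoord p ((extChartAt (𝓡 m) p).symm u)))

lemma metricCoord_apply (p : M) (u A B : E m) :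
    metricCoord g p u A B = g.inner ((extChartAt (𝓡 m) p).symm u)
      (ofCoord p ((extChartAt (𝓡 m) p).symm u) A) (ofCoord p ((extChartAt (𝓡 m) p).symm u) B) :=
  rfl

lemma gram_apply (p : M) (u : E m) (i j : Fin m) :
    gram g p u i j = metricCoord g p u (e i) (e j) := rfl

lemma metricCoord_symm (p : M) (u A B : E m) :
    metricCoord g p u A B = metricCoord g p u B A := g.symm _ _ _

lemma metricCoord_pos {p : M} {u : E m} (hu : u ∈ (extChartAt (𝓡 m) p).target) {A : E m}
    (hA : A ≠ 0) : 0 < metricCoord g p u A A := by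
  refine g.pos _ _ fun h => hA ?_
  rw [← coord_ofCoord ((extChartAt (𝓡 m) p).map_target hu) A]
  exact (congrArg _ h).trans (map_zero _)

lemma metricCoord_coord {p q : M} (hq : q ∈ (extChartAt (𝓡 m) p).source)
    (v w : TangentSpace (𝓡 m) q) :
    metricCoord g p (extChartAt (𝓡 m) p q) (coord p q v) (coord p q w) = g.inner q v w := by
  rw [metricCoord_apply, (extChartAt (𝓡 m) p).left_inv hq, ofCoord_coord hq, ofCoord_coord hq]

lemma contDiffOn_metricCoord (p : M) :
    ContDiffOn ℝ ∞ (metricCoord g p) (extChartAt (𝓡 m) p).target := by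
  rw [contDiffOn_clm_apply]
  intro A
  rw [contDiffOn_clm_apply]
  intro B
  rw [← contMDiffOn_iff_contDiffOn]
  have h1 : ContMDiffOn 𝓘(ℝ, E m) (𝓡 m) ∞ (extChartAt (𝓡 m) p).symm (extChartAt (𝓡 m) p).target :=
    contMDiffOn_extChartAt_symm p
  have h2 := fun A => (contMDiffOn_ofCoord p A).comp h1
    fun u hu => (extChartAt (𝓡 m) p).map_target hu
  have h3 := ContMDiffOn.clm_bundle_apply₂ (F₁ := E m) (F₂ := E m) (F₃ := ℝ)
    (E₃ := Bundle.Trivial M ℝ) (g.contMDiff.comp_contMDiffOn h1) (h2 A) (h2 B)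
  intro u hu
  exact (Bundle.contMDiffWithinAt_totalSpace.1 (h3 u hu)).2

lemma contDiffAt_metricCoord {p : M} {u : E m} (hu : u ∈ (extChartAt (𝓡 m) p).target) :
    ContDiffAt ℝ ∞ (metricCoord g p) u :=
  (contDiffOn_metricCoord g p).contDiffAt ((isOpen_target p).mem_nhds hu)

/-- A kernel vector v of the Gram matrix would satisfy ⟨v, v⟩ = 0, against positivity. -/
lemma isUnit_det_gram {p : M} {u : E m} (hu : u ∈ (extChartAt (𝓡 m) p).target) :
    IsUnit (gram g p u).det := by
  rw [isUnit_iff_ne_zero]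
  intro h
  obtain ⟨v, hv, hv0⟩ := Matrix.exists_mulVec_eq_zero_iff.mpr h
  have hne : (WithLp.toLp 2 v : E m) ≠ 0 := fun h => hv (by simpa using h)
  have h1 := metricCoord_pos g hu hne
  have h2 : metricCoord g p u (WithLp.toLp 2 v) (WithLp.toLp 2 v) =
      v ⬝ᵥ (gram g p u).mulVec v := by
    conv_lhs => rw [← sum_smul_e (WithLp.toLp 2 v : E m)]
    rw [map_sum]
    simp only [map_sum, map_smul, _root_.sum_apply, _root_.smul_apply,
      smul_eq_mul, Finset.mul_sum, Matrix.mulVec, dotProduct, gram_apply]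
    refine Finset.sum_congr rfl fun i _ => Finset.sum_congr rfl fun j _ => ?_
    rw [metricCoord_symm]
    ring
  rw [h2, hv0] at h1
  simp at h1

/-- The derivative of the metric in the preferred chart around `p`. -/
def dmetric (p : M) (u Z X Y : E m) : ℝ := fderiv ℝ (fun u' => metricCoord g p u' X Y) u Z

lemma dgram_eq (p : M) (u : E m) (k i j : Fin m) :
    dgram g p u k i j = dmetric g p u (e k) (e i) (e j) := rfl

lemma dmetric_eq {p : M} {u : E m} (hu : u ∈ (extChartAt (𝓡 m) p).target) (Z X Y : E m) :
    dmetric g p u Z X Y = fderiv ℝ (metricCoord g p) u Z X Y := by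
  have h := (contDiffAt_metricCoord g hu).differentiableAt (by simp)
  have h1 : HasFDerivAt (fun u => metricCoord g p u X Y) _ u :=
    (h.hasFDerivAt.clm_apply (hasFDerivAt_const X u)).clm_apply (hasFDerivAt_const Y u)
  rw [dmetric, h1.fderiv]
  simp

lemma dmetric_symm (p : M) (u Z X Y : E m) : dmetric g p u Z X Y = dmetric g p u Z Y X := by
  rw [dmetric, dmetric]
  congr 3
  ext1 u'
  exact metricCoord_symm g p u' X Y

lemma dmetric_sum {p : M} {u : E m} (hu : u ∈ (extChartAt (𝓡 m) p).target) (Z X Y : E m) :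
    dmetric g p u Z X Y =
      ∑ k, ∑ i, ∑ j, Z k * X i * Y j * dgram g p u k i j := by
  have h : ∀ k, dmetric g p u (e k) X Y = ∑ i, ∑ j, X i * Y j * dgram g p u k i j := fun k => by
    simp only [dgram_eq, dmetric_eq g hu]
    exact apply_apply_eq_sum _ X Y
  rw [dmetric, apply_eq_sum]
  refine Finset.sum_congr rfl fun k _ => ?_
  rw [← dmetric, h, Finset.mul_sum]
  refine Finset.sum_congr rfl fun i _ => ?_
  rw [Finset.mul_sum]
  exact Finset.sum_congr rfl fun j _ => by ring

lemma sum_gram_mul_christoffel {p : M} {u : E m} (hu : u ∈ (extChartAt (𝓡 m) p).target)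
    (l i j : Fin m) : ∑ k, gram g p u l k * christoffel g p u k i j =
      (1 / 2) * (dgram g p u i j l + dgram g p u j i l - dgram g p u l i j) := by
  have h : ∀ n, ∑ k, gram g p u l k * (gram g p u)⁻¹ k n = if l = n then 1 else 0 := fun n => by
    rw [← Matrix.mul_apply, Matrix.mul_nonsing_inv _ (isUnit_det_gram g hu), Matrix.one_apply]
  simp only [christoffel, Finset.mul_sum]
  rw [Finset.sum_comm]
  have h2 : ∀ n, ∑ k, gram g p u l k * (1 / 2 * ((gram g p u)⁻¹ k n *
      (dgram g p u i j n + dgram g p u j i n - dgram g p u n i j))) =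
      (∑ k, gram g p u l k * (gram g p u)⁻¹ k n) *
      ((1 / 2) * (dgram g p u i j n + dgram g p u j i n - dgram g p u n i j)) := fun n => by
    rw [Finset.sum_mul]
    exact Finset.sum_congr rfl fun k _ => by ring
  simp only [h2, h]
  simp

/-- The Koszul formula: pairing with the metric cancels the inverse Gram matrix in `christoffel`. It
determines `Gam` because the metric is nondegenerate. -/
lemma metricCoord_Gam {p : M} {u : E m} (hu : u ∈ (extChartAt (𝓡 m) p).target) (Y W Z : E m) :
    metricCoord g p u (Gam g p u Y W) Z =
      (1 / 2) * (dmetric g p u Y W Z + dmetric g p u W Y Z - dmetric g p u Z Y W) := by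
  have h1 : metricCoord g p u (Gam g p u Y W) Z = ∑ l, ∑ i, ∑ j, Z l * Y i * W j *
      ∑ k, gram g p u l k * christoffel g p u k i j := by
    rw [apply_eq_sum]
    refine Finset.sum_congr rfl fun l _ => ?_
    rw [metricCoord_symm, apply_eq_sum]
    simp only [Finset.mul_sum, ← gram_apply, Gam, Finset.sum_mul]
    rw [Finset.sum_comm]
    refine Finset.sum_congr rfl fun i _ => ?_
    rw [Finset.sum_comm]
    exact Finset.sum_congr rfl fun j _ => Finset.sum_congr rfl fun k _ => by ring
  have h2 : dmetric g p u Y W Z = ∑ l, ∑ i, ∑ j, Z l * Y i * W j * dgram g p u i j l := by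
    rw [dmetric_sum g hu]
    conv_rhs => rw [Finset.sum_comm]
    refine Finset.sum_congr rfl fun i _ => ?_
    conv_rhs => rw [Finset.sum_comm]
    exact Finset.sum_congr rfl fun j _ => Finset.sum_congr rfl fun k _ => by ring
  have h3 : dmetric g p u W Y Z = ∑ l, ∑ i, ∑ j, Z l * Y i * W j * dgram g p u j i l := by
    rw [dmetric_sum g hu, Finset.sum_comm]
    conv_rhs => rw [Finset.sum_comm]
    refine Finset.sum_congr rfl fun i _ => ?_
    conv_rhs => rw [Finset.sum_comm]
    exact Finset.sum_congr rfl fun j _ => Finset.sum_congr rfl fun k _ => by ring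
  rw [h1, h2, h3, dmetric_sum g hu, ← Finset.sum_add_distrib, ← Finset.sum_sub_distrib,
    Finset.mul_sum]
  refine Finset.sum_congr rfl fun l _ => ?_
  rw [← Finset.sum_add_distrib, ← Finset.sum_sub_distrib, Finset.mul_sum]
  refine Finset.sum_congr rfl fun i _ => ?_
  rw [← Finset.sum_add_distrib, ← Finset.sum_sub_distrib, Finset.mul_sum]
  refine Finset.sum_congr rfl fun j _ => ?_
  rw [sum_gram_mul_christoffel g hu]
  ring

lemma Gam_symm (p : M) (u Y W : E m) : Gam g p u Y W = Gam g p u W Y := by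
  have h : ∀ i j k, dgram g p u i j k = dgram g p u i k j := fun i j k => dmetric_symm g p u _ _ _
  ext k
  simp only [Gam]
  rw [Finset.sum_comm]
  refine Finset.sum_congr rfl fun i _ => Finset.sum_congr rfl fun j _ => ?_
  have : christoffel g p u k j i = christoffel g p u k i j := by
    simp only [christoffel, h _ i j, add_comm]
  rw [this]
  ring

/-- Metric compatibility: in the sum of the two Koszul formulas everything cancels except the
derivative along Z. -/
lemma dmetric_eq_Gam {p : M} {u : E m} (hu : u ∈ (extChartAt (𝓡 m) p).target) (Z X Y : E m) :
    dmetric g p u Z X Y =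
      metricCoord g p u (Gam g p u Z X) Y + metricCoord g p u X (Gam g p u Z Y) := by
  rw [metricCoord_symm g p u X, metricCoord_Gam g hu, metricCoord_Gam g hu, dmetric_symm g p u Z Y,
    dmetric_symm g p u X Z, dmetric_symm g p u Y Z]
  ring

/-- Two vectors with the same pairings against all vectors are equal. -/
lemma metricCoord_ext {p : M} {u : E m} (hu : u ∈ (extChartAt (𝓡 m) p).target) {A B : E m}
    (h : ∀ Z, metricCoord g p u A Z = metricCoord g p u B Z) : A = B := by
  by_contra hne
  have h1 := metricCoord_pos g hu (sub_ne_zero.mpr hne)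
  have h2 := h (A - B)
  rw [metricCoord_symm g p u A, metricCoord_symm g p u B] at h2
  rw [map_sub, h2, sub_self] at h1
  exact lt_irrefl _ h1

end Chart

/-! ### Smoothness of the Christoffel symbols and their behaviour under a change of chart. -/

section Transition

open Filter Topology

variable {m : ℕ} {M : Type*} [TopologicalSpace M] [ChartedSpace (E m) M]
  [IsManifold (𝓡 m) ∞ M] (g : Metric m M)

set_option synthInstance.maxHeartbeats 200000 in
lemma fderiv_bilin_apply {V F : Type*} [NormedAddCommGroup V] [NormedSpace ℝ V]
    [NormedAddCommGroup F] [NormedSpace ℝ F] {B : V → F →L[ℝ] F →L[ℝ] ℝ}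
    {B' : V →L[ℝ] F →L[ℝ] F →L[ℝ] ℝ} {a b : V → F} {a' b' : V →L[ℝ] F} {u : V}
    (hB : HasFDerivAt B B' u) (ha : HasFDerivAt a a' u) (hb : HasFDerivAt b b' u) (Z : V) :
    fderiv ℝ (fun v => B v (a v) (b v)) u Z =
      B' Z (a u) (b u) + B u (a' Z) (b u) + B u (a u) (b' Z) := by
  rw [((hB.clm_apply ha).clm_apply hb).fderiv]
  simp only [_root_.add_apply, ContinuousLinearMap.comp_apply, ContinuousLinearMap.flip_apply]
  ring

set_option synthInstance.maxHeartbeats 200000 in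
lemma HasDerivWithinAt.bilin_apply {F : Type*}
    [NormedAddCommGroup F] [NormedSpace ℝ F] {B : ℝ → F →L[ℝ] F →L[ℝ] ℝ}
    {B' : F →L[ℝ] F →L[ℝ] ℝ} {a b : ℝ → F} {a' b' : F} {S : Set ℝ} {s : ℝ}
    (hB : HasDerivWithinAt B B' S s) (ha : HasDerivWithinAt a a' S s)
    (hb : HasDerivWithinAt b b' S s) :
    HasDerivWithinAt (fun v => B v (a v) (b v))
      (B' (a s) (b s) + B s a' (b s) + B s (a s) b') S s := by
  simpa using (hB.clm_apply ha).clm_apply hb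

lemma contDiffAt_gram {p : M} {u : E m} (hu : u ∈ (extChartAt (𝓡 m) p).target) (i j : Fin m) :
    ContDiffAt ℝ ∞ (fun u => gram g p u i j) u :=
  ((contDiffAt_metricCoord g hu).clm_apply contDiffAt_const).clm_apply contDiffAt_const

lemma contDiffAt_dgram {p : M} {u : E m} (hu : u ∈ (extChartAt (𝓡 m) p).target)
    (k i j : Fin m) : ContDiffAt ℝ ∞ (fun u => dgram g p u k i j) u :=
  ((contDiffAt_gram g hu i j).fderiv_right (m := ∞) (by simp)).clm_apply contDiffAt_const

lemma contDiffAt_det {V ι : Type*} [NormedAddCommGroup V] [NormedSpace ℝ V] [Fintype ι]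
    [DecidableEq ι] {A : V → Matrix ι ι ℝ} {u : V} {n : WithTop ℕ∞}
    (hA : ∀ i j, ContDiffAt ℝ n (fun u => A u i j) u) : ContDiffAt ℝ n (fun u => (A u).det) u := by
  simp only [Matrix.det_apply']
  exact ContDiffAt.sum fun σ _ => contDiffAt_const.mul (contDiffAt_prod fun i _ => hA _ _)

/-- By Cramer's rule the entries of the inverse are quotients of determinants. -/
lemma contDiffAt_matrix_inv {V ι : Type*} [NormedAddCommGroup V] [NormedSpace ℝ V] [Fintype ι]
    [DecidableEq ι] {A : V → Matrix ι ι ℝ} {u : V} {n : WithTop ℕ∞}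
    (hA : ∀ i j, ContDiffAt ℝ n (fun u => A u i j) u) (hu : IsUnit (A u).det) (i j : ι) :
    ContDiffAt ℝ n (fun u => (A u)⁻¹ i j) u := by
  simp only [Matrix.inv_def, Matrix.smul_apply, Ring.inverse_eq_inv', smul_eq_mul,
    Matrix.adjugate_apply]
  refine ((contDiffAt_det hA).inv hu.ne_zero).mul (contDiffAt_det fun k l => ?_)
  by_cases h : k = j
  · subst h
    simpa using contDiffAt_const
  · simpa [Matrix.updateRow_ne h] using hA k l

lemma contDiffAt_christoffel {p : M} {u : E m} (hu : u ∈ (extChartAt (𝓡 m) p).target)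
    (k i j : Fin m) : ContDiffAt ℝ ∞ (fun u => christoffel g p u k i j) u := by
  refine contDiffAt_const.mul (ContDiffAt.sum fun l _ => ?_)
  exact (contDiffAt_matrix_inv (contDiffAt_gram g hu) (isUnit_det_gram g hu) k l).mul
    (((contDiffAt_dgram g hu _ _ _).add (contDiffAt_dgram g hu _ _ _)).sub
      (contDiffAt_dgram g hu _ _ _))

lemma contDiffWithinAt_Gam {V : Type*} [NormedAddCommGroup V] [NormedSpace ℝ V] {p : M}
    {u Y W : V → E m} {S : Set V} {s : V} {n : ℕ} (hu : u s ∈ (extChartAt (𝓡 m) p).target)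
    (hu' : ContDiffWithinAt ℝ n u S s) (hY : ContDiffWithinAt ℝ n Y S s)
    (hW : ContDiffWithinAt ℝ n W S s) :
    ContDiffWithinAt ℝ n (fun s => Gam g p (u s) (Y s) (W s)) S s := by
  have hY' := contDiffWithinAt_euclidean.1 hY
  have hW' := contDiffWithinAt_euclidean.1 hW
  refine contDiffWithinAt_euclidean.2 fun k => ?_
  change ContDiffWithinAt ℝ n
    (fun s => ∑ i, ∑ j, christoffel g p (u s) k i j * Y s i * W s j) S s
  refine ContDiffWithinAt.sum fun i _ => ContDiffWithinAt.sum fun j _ => ?_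
  have h : ContDiffAt ℝ n (fun u => christoffel g p u k i j) (u s) :=
    (contDiffAt_christoffel g hu k i j).of_le ENat.LEInfty.out
  exact ((h.comp_contDiffWithinAt s hu').mul (hY' i)).mul (hW' j)

/-- The Jacobi operator is self-adjoint in coordinates. -/
lemma curvCoord_jacobi_symm {p : M} {u : E m} (hu : u ∈ (extChartAt (𝓡 m) p).target)
    (X Y T : E m) : metricCoord g p u (curvCoord g p u X T T) Y =
      metricCoord g p u X (curvCoord g p u Y T T) := by
  refine curvOf_jacobi_symm (G := metricCoord g p) (Γ := Gam g p)
    ((contDiffAt_metricCoord g hu).of_le ENat.LEInfty.out) (metricCoord_symm g p u) ?_ ?_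
    (Gam_symm g p) X Y T
  · filter_upwards [(isOpen_target p).mem_nhds hu] with v hv
    exact dmetric_eq_Gam g hv
  · intro X Y
    have h : ContDiffWithinAt ℝ (1 : ℕ) (fun u => Gam g p u X Y) Set.univ u :=
      contDiffWithinAt_Gam g hu contDiffWithinAt_id contDiffWithinAt_const contDiffWithinAt_const
    exact (contDiffWithinAt_univ.1 h).differentiableAt (by norm_num)

/-- The transition map from the preferred chart around `p` to the one around `q`. -/
def transition (p q : M) (u : E m) : E m := extChartAt (𝓡 m) q ((extChartAt (𝓡 m) p).symm u)

omit [IsManifold (𝓡 m) ∞ M] in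
lemma transition_extChartAt {p r : M} (hp : r ∈ (extChartAt (𝓡 m) p).source) (q : M) :
    transition p q (extChartAt (𝓡 m) p r) = extChartAt (𝓡 m) q r := by
  rw [transition, (extChartAt (𝓡 m) p).left_inv hp]

lemma contDiffAt_transition {p q : M} {u : E m} (hu : u ∈ (extChartAt (𝓡 m) p).target)
    (hq : (extChartAt (𝓡 m) p).symm u ∈ (extChartAt (𝓡 m) q).source) :
    ContDiffAt ℝ ∞ (transition p q) u := by
  rw [← contMDiffAt_iff_contDiffAt]
  have h1 : ContMDiffAt (𝓡 m) 𝓘(ℝ, E m) ∞ (extChartAt (𝓡 m) q) ((extChartAt (𝓡 m) p).symm u) :=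
    contMDiffAt_extChartAt' (by simpa using hq)
  exact h1.comp u ((contMDiffOn_extChartAt_symm p).contMDiffAt ((isOpen_target p).mem_nhds hu))

lemma fderiv_transition_coord {p q r : M} (hp : r ∈ (extChartAt (𝓡 m) p).source)
    (hq : r ∈ (extChartAt (𝓡 m) q).source) (v : TangentSpace (𝓡 m) r) :
    fderiv ℝ (transition p q) (extChartAt (𝓡 m) p r) (coord p r v) = coord q r v := by
  have := isManifold_one (m := m) (M := M)
  have hτ : DifferentiableAt ℝ (transition p q) (extChartAt (𝓡 m) p r) :=
    (contDiffAt_transition ((extChartAt (𝓡 m) p).map_source hp)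
      (by rwa [(extChartAt (𝓡 m) p).left_inv hp])).differentiableAt (by simp)
  have h1 : MDifferentiableAt (𝓡 m) 𝓘(ℝ, E m) (extChartAt (𝓡 m) p) r :=
    mdifferentiableAt_extChartAt (by simpa using hp)
  have h2 := mfderiv_comp r hτ.mdifferentiableAt h1
  have h3 : transition p q ∘ extChartAt (𝓡 m) p =ᶠ[𝓝 r] extChartAt (𝓡 m) q := by
    filter_upwards [(isOpen_extChartAt_source p).mem_nhds hp] with s hs
    exact transition_extChartAt hs q
  rw [h3.mfderiv_eq, mfderiv_eq_fderiv] at h2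
  exact (DFunLike.congr_fun h2 v).symm

set_option synthInstance.maxHeartbeats 200000 in
/-- The transformation law of the Christoffel symbols. -/
lemma fderiv_transition_Gam {p q : M} {u : E m} (hu : u ∈ (extChartAt (𝓡 m) p).target)
    (hq : (extChartAt (𝓡 m) p).symm u ∈ (extChartAt (𝓡 m) q).source) (Y W : E m) :
    fderiv ℝ (transition p q) u (Gam g p u Y W) =
      fderiv ℝ (fderiv ℝ (transition p q)) u Y W +
        Gam g q (transition p q u) (fderiv ℝ (transition p q) u Y)
          (fderiv ℝ (transition p q) u W) := by
  set τ := transition (m := m) p q with hτdef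
  set T := fderiv ℝ τ u with hT
  have hτu : τ u ∈ (extChartAt (𝓡 m) q).target := (extChartAt (𝓡 m) q).map_source hq
  have hτ := contDiffAt_transition hu hq
  have hτd := hτ.differentiableAt (by simp)
  have hτ' : DifferentiableAt ℝ (fderiv ℝ τ) u :=
    (hτ.fderiv_right (m := 1) (by rw [one_add_one_eq_two]; exact ENat.LEInfty.out)).differentiableAt
      (by norm_num)
  -- The metric in chart p is the pullback of the metric in chart q under τ. This holds near u, so
  -- it can be differentiated.
  have hpull : ∀ {v}, v ∈ (extChartAt (𝓡 m) p).target →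
      (extChartAt (𝓡 m) p).symm v ∈ (extChartAt (𝓡 m) q).source → ∀ A B,
      metricCoord g p v A B = metricCoord g q (τ v) (fderiv ℝ τ v A) (fderiv ℝ τ v B) := by
    intro v hv hvq A B
    have hvp := (extChartAt (𝓡 m) p).map_target hv
    have h : ∀ A, fderiv ℝ τ v A =
        coord (m := m) q _ (ofCoord p ((extChartAt (𝓡 m) p).symm v) A) := by
      intro A
      rw [← fderiv_transition_coord hvp hvq, (extChartAt (𝓡 m) p).right_inv hv, coord_ofCoord hvp]
    rw [h, h, hτdef, transition, metricCoord_coord g hvq, metricCoord_apply]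
  have hup := (extChartAt (𝓡 m) p).map_target hu
  -- `T` is onto
  have hTsurj : ∀ Z, T (coord (m := m) p _ (ofCoord q ((extChartAt (𝓡 m) p).symm u) Z)) = Z := by
    intro Z
    have h := fderiv_transition_coord hup hq (ofCoord q _ Z)
    rwa [(extChartAt (𝓡 m) p).right_inv hu, coord_ofCoord hq] at h
  -- T⁻¹N is the pullback of the connection of chart q. It is symmetric and compatible with the
  -- metric of chart p, so by uniqueness in the Koszul formula it equals `Gam g p u`.
  set N : E m → E m → E m := fun Y W =>
    fderiv ℝ (fderiv ℝ τ) u Y W + Gam g q (τ u) (T Y) (T W) with hN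
  have hNsymm : ∀ Y W, N Y W = N W Y := fun Y W => by
    simp only [hN]
    rw [Gam_symm g q, (hτ.isSymmSndFDerivAt (by simpa using ENat.LEInfty.out)) Y W]
  have hD : ∀ Z A B, dmetric g p u Z A B =
      metricCoord g q (τ u) (N Z A) (T B) + metricCoord g q (τ u) (T A) (N Z B) := by
    intro Z A B
    have hev : (fun v => metricCoord g p v A B) =ᶠ[𝓝 u]
        fun v => metricCoord g q (τ v) (fderiv ℝ τ v A) (fderiv ℝ τ v B) := by
      filter_upwards [(isOpen_target p).mem_nhds hu,
        ((continuousOn_extChartAt_symm p).continuousAt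
          ((isOpen_target p).mem_nhds hu)).preimage_mem_nhds
          ((isOpen_extChartAt_source q).mem_nhds hq)] with v hv hvq
      exact hpull hv hvq A B
    have hG : HasFDerivAt (fun v => metricCoord g q (τ v)) _ u :=
      ((contDiffAt_metricCoord g hτu).differentiableAt (by simp)).hasFDerivAt.comp u
        hτd.hasFDerivAt
    have hA : ∀ A, HasFDerivAt (fun v => fderiv ℝ τ v A) _ u := fun A =>
      hτ'.hasFDerivAt.clm_apply (hasFDerivAt_const A u)
    rw [dmetric, hev.fderiv_eq, fderiv_bilin_apply hG (hA A) (hA B), ContinuousLinearMap.comp_apply,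
      ← dmetric_eq g hτu, dmetric_eq_Gam g hτu]
    simp only [_root_.add_apply, ContinuousLinearMap.comp_apply,
      ContinuousLinearMap.flip_apply, _root_.zero_apply, map_zero, zero_add, ← hT, hN, map_add]
    ring
  have key := koszul_of_compatible (B := metricCoord g p u) (D := dmetric g p u)
    (Γ := fun Y W => coord (m := m) p _ (ofCoord q ((extChartAt (𝓡 m) p).symm u) (N Y W)))
    (metricCoord_symm g p u) (fun Y W => by simp only [hNsymm Y W])
    (fun Z A B => by rw [hpull hu hq, hpull hu hq, ← hT, hTsurj, hTsurj, hD]) Y W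
  have h : Gam g p u Y W = coord (m := m) p _ (ofCoord q ((extChartAt (𝓡 m) p).symm u) (N Y W)) :=
    metricCoord_ext g hu fun Z => by rw [key, metricCoord_Gam g hu]
  rw [h, hTsurj]

end Transition

/-! ### Curves and fields along them in a fixed chart. -/

section Curve

open Filter Topology Set

variable {m : ℕ} {M : Type*} [TopologicalSpace M] [ChartedSpace (E m) M]

/-- A curve in the preferred chart around `p`. -/
def curveCoord (p : M) (x : ℝ → M) (s : ℝ) : E m := extChartAt (𝓡 m) p (x s)

/-- A field along a curve in the preferred chart around `p`. -/
def fieldCoord (p : M) (x : ℝ → M) (V : (t : ℝ) → TangentSpace (𝓡 m) (x t)) (s : ℝ) : E m :=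
  coord p (x s) (V s)

lemma eventually_mem_source {p : M} {x : ℝ → M} {S : Set ℝ} {s : ℝ}
    (hx : ContinuousWithinAt x S s) (hp : x s ∈ (extChartAt (𝓡 m) p).source) :
    ∀ᶠ r in 𝓝[S] s, x r ∈ (extChartAt (𝓡 m) p).source :=
  hx.preimage_mem_nhdsWithin ((isOpen_extChartAt_source p).mem_nhds hp)

variable [IsManifold (𝓡 m) ∞ M]

lemma contDiffWithinAt_curveCoord {n : ℕ} {p : M} {x : ℝ → M} {S : Set ℝ} {s : ℝ}
    (hx : ContMDiffWithinAt 𝓘(ℝ, ℝ) (𝓡 m) n x S s) (hp : x s ∈ (extChartAt (𝓡 m) p).source) :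
    ContDiffWithinAt ℝ n (curveCoord (m := m) p x) S s := by
  rw [← contMDiffWithinAt_iff_contDiffWithinAt]
  have h : ContMDiffAt (𝓡 m) 𝓘(ℝ, E m) n (extChartAt (𝓡 m) p) (x s) :=
    (contMDiffAt_extChartAt' (n := ∞) (by simpa using hp)).of_le ENat.LEInfty.out
  exact h.comp_contMDiffWithinAt s hx

lemma contMDiffWithinAt_base {n : ℕ} {x : ℝ → M} {V : (t : ℝ) → TangentSpace (𝓡 m) (x t)}
    {S : Set ℝ} {s : ℝ} (h : ContMDiffWithinAt 𝓘(ℝ, ℝ) (𝓡 m).tangent n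
      (fun t => (⟨x t, V t⟩ : TangentBundle (𝓡 m) M)) S s) :
    ContMDiffWithinAt 𝓘(ℝ, ℝ) (𝓡 m) n x S s :=
  (Bundle.contMDiffWithinAt_totalSpace.1 h).1

lemma contDiffWithinAt_fieldCoord {n : ℕ} {p : M} {x : ℝ → M}
    {V : (t : ℝ) → TangentSpace (𝓡 m) (x t)} {S : Set ℝ} {s : ℝ}
    (h : ContMDiffWithinAt 𝓘(ℝ, ℝ) (𝓡 m).tangent n
      (fun t => (⟨x t, V t⟩ : TangentBundle (𝓡 m) M)) S s)
    (hp : x s ∈ (extChartAt (𝓡 m) p).source) :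
    ContDiffWithinAt ℝ n (fieldCoord p x V) S s := by
  have := isManifold_one (m := m) (M := M)
  have : ContMDiffVectorBundle n (E m) (TangentSpace (𝓡 m) (M := M)) (𝓡 m) :=
    ContMDiffVectorBundle.of_le (n := ∞) (m := n) ENat.LEInfty.out
  rw [← contMDiffWithinAt_iff_contDiffWithinAt]
  have h2 := ((trivializationAt (E m) (TangentSpace (𝓡 m)) p).contMDiffWithinAt_iff
    (by simpa [Bundle.Trivialization.mem_source] using hp)).1 h
  refine h2.2.congr_of_eventuallyEq ?_ (coord_eq_trivializationAt hp _)
  filter_upwards [eventually_mem_source h2.1.continuousWithinAt hp] with r hr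
  exact coord_eq_trivializationAt hr _

lemma coord_velocity {t₀ t₁ : ℝ} (ht : t₀ < t₁) {p : M} {x : ℝ → M} {s : ℝ}
    (hs : s ∈ Icc t₀ t₁) (hx : ContMDiffWithinAt 𝓘(ℝ, ℝ) (𝓡 m) 1 x (Icc t₀ t₁) s)
    (hp : x s ∈ (extChartAt (𝓡 m) p).source) :
    coord p (x s) (velocity t₀ t₁ x s) = derivWithin (curveCoord (m := m) p x) (Icc t₀ t₁) s := by
  have := isManifold_one (m := m) (M := M)
  have h1 : MDifferentiableAt (𝓡 m) 𝓘(ℝ, E m) (extChartAt (𝓡 m) p) (x s) :=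
    mdifferentiableAt_extChartAt (by simpa using hp)
  have h2 := mfderiv_comp_mfderivWithin s h1 (hx.mdifferentiableWithinAt one_ne_zero)
    ((uniqueDiffOn_Icc ht) s hs).uniqueMDiffWithinAt
  rw [mfderivWithin_eq_fderivWithin] at h2
  exact (DFunLike.congr_fun h2 (1 : ℝ)).symm

variable (g : Metric m M)

/-- The covariant derivative of a field along a curve, in any chart. -/
lemma fieldCoord_covDeriv {t₀ t₁ : ℝ} (ht : t₀ < t₁) {p : M} {x : ℝ → M}
    {V : (t : ℝ) → TangentSpace (𝓡 m) (x t)} {s : ℝ} (hs : s ∈ Icc t₀ t₁)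
    (hV : ContMDiffWithinAt 𝓘(ℝ, ℝ) (𝓡 m).tangent 1
      (fun t => (⟨x t, V t⟩ : TangentBundle (𝓡 m) M)) (Icc t₀ t₁) s)
    (hp : x s ∈ (extChartAt (𝓡 m) p).source) :
    fieldCoord p x (covDeriv g t₀ t₁ x (Icc t₀ t₁) V) s =
      derivWithin (fieldCoord p x V) (Icc t₀ t₁) s + Gam g p (curveCoord (m := m) p x s)
        (derivWithin (curveCoord (m := m) p x) (Icc t₀ t₁) s) (fieldCoord p x V s) := by
  have hx := contMDiffWithinAt_base (n := 1) hV
  have hq := mem_extChartAt_source (I := 𝓡 m) (x s)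
  have hut : curveCoord (m := m) p x s ∈ (extChartAt (𝓡 m) p).target :=
    (extChartAt (𝓡 m) p).map_source hp
  have huq : (extChartAt (𝓡 m) p).symm (curveCoord (m := m) p x s) ∈
      (extChartAt (𝓡 m) (x s)).source := by
    rwa [curveCoord, (extChartAt (𝓡 m) p).left_inv hp]
  have hu := ((contDiffWithinAt_curveCoord (n := 1) hx hp).differentiableWithinAt
    (by norm_num)).hasDerivWithinAt
  have hw := ((contDiffWithinAt_fieldCoord (n := 1) hV hp).differentiableWithinAt
    (by norm_num)).hasDerivWithinAt
  have hτ := contDiffAt_transition hut huq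
  have hτ' : DifferentiableAt ℝ (fderiv ℝ (transition p (x s))) (curveCoord (m := m) p x s) :=
    (hτ.fderiv_right (m := 1) (by rw [one_add_one_eq_two]; exact ENat.LEInfty.out)).differentiableAt
      (by norm_num)
  have h1 := (hτ'.hasFDerivAt.comp_hasDerivWithinAt s hu).clm_apply hw
  have hlaw : ∀ {r}, x r ∈ (extChartAt (𝓡 m) p).source → x r ∈ (extChartAt (𝓡 m) (x s)).source →
      ∀ v, coord (x s) (x r) v =
        fderiv ℝ (transition p (x s)) (curveCoord (m := m) p x r) (coord p (x r) v) :=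
    fun hr hr' v => (fderiv_transition_coord hr hr' v).symm
  have hev : fieldCoord (x s) x V =ᶠ[𝓝[Icc t₀ t₁] s] fun r =>
      (fderiv ℝ (transition p (x s)) ∘ curveCoord (m := m) p x) r (fieldCoord p x V r) := by
    filter_upwards [eventually_mem_source hx.continuousWithinAt hp,
      eventually_mem_source hx.continuousWithinAt hq] with r hr hr'
    exact hlaw hr hr' _
  have h2 := h1.congr_of_eventuallyEq hev (hlaw hp hq _)
  have h3 := h2.derivWithin ((uniqueDiffOn_Icc ht) s hs)
  rw [fieldCoord, covDeriv, show derivWithin (fun r => coord (x s) (x r) (V r)) _ _ = _ from h3,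
    hlaw hp hq, hlaw hp hq, coord_velocity ht hs hx hp,
    ← transition_extChartAt hp (x s)]
  change coord p (x s) (ofCoord (x s) (x s) (_ + _ + Gam g (x s) (transition p (x s)
    (curveCoord (m := m) p x s)) _ (fderiv ℝ (transition p (x s)) _ (fieldCoord p x V s)))) = _
  -- The product rule applied to Dτ(u)V gave a term D²τ(u', V); the transformation law absorbs it.
  have h4 := fderiv_transition_Gam g hut huq (derivWithin (curveCoord (m := m) p x) (Icc t₀ t₁) s)
    (fieldCoord p x V s)
  set Y := derivWithin (fieldCoord p x V) (Icc t₀ t₁) s + Gam g p (curveCoord (m := m) p x s)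
        (derivWithin (curveCoord (m := m) p x) (Icc t₀ t₁) s) (fieldCoord p x V s) with hY
  have h5 : coord (x s) (x s) (ofCoord p (x s) Y) =
      fderiv ℝ (transition p (x s)) (curveCoord (m := m) p x s) Y := by
    rw [hlaw hp hq, coord_ofCoord hp]
  rw [add_right_comm, ← h4, add_comm, Function.comp_apply, ← map_add, ← hY, ← h5,
    ofCoord_coord hq, coord_ofCoord hp]

end Curve

/-! ### One-sided calculus along the curve and Green's identity. -/

section Extremal

open Filter Topology Set

variable {m : ℕ} {M : Type*} [TopologicalSpace M] [ChartedSpace (E m) M]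
  [IsManifold (𝓡 m) ∞ M] (g : Metric m M) {t₀ t₁ : ℝ} {x : ℝ → M}

lemma inner_eventuallyEq_metricCoord {p : M} {S : Set ℝ} {t : ℝ}
    (hx : ContinuousWithinAt x S t) (hp : x t ∈ (extChartAt (𝓡 m) p).source)
    (V Z : (t : ℝ) → TangentSpace (𝓡 m) (x t)) :
    (fun s => g.inner (x s) (V s) (Z s)) =ᶠ[𝓝[S] t] fun s =>
      metricCoord g p (curveCoord p x s) (fieldCoord p x V s) (fieldCoord p x Z s) := by
  filter_upwards [eventually_mem_source hx hp] with s hs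
  exact (metricCoord_coord g hs _ _).symm

lemma continuousWithinAt_inner {p : M} {S : Set ℝ} {t : ℝ}
    {V Z : (t : ℝ) → TangentSpace (𝓡 m) (x t)}
    (hx : ContMDiffWithinAt 𝓘(ℝ, ℝ) (𝓡 m) 1 x S t) (hp : x t ∈ (extChartAt (𝓡 m) p).source)
    (hV : ContinuousWithinAt (fieldCoord p x V) S t)
    (hZ : ContinuousWithinAt (fieldCoord p x Z) S t) :
    ContinuousWithinAt (fun s => g.inner (x s) (V s) (Z s)) S t := by
  have hu := (contDiffWithinAt_curveCoord (n := 1) hx hp).continuousWithinAt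
  have hG : ContinuousAt (metricCoord g p) (curveCoord p x t) :=
    (contDiffAt_metricCoord g ((extChartAt (𝓡 m) p).map_source hp)).continuousAt
  refine (((hG.comp_continuousWithinAt hu).clm_apply hV).clm_apply hZ).congr_of_eventuallyEq
    (inner_eventuallyEq_metricCoord g hx.continuousWithinAt hp V Z) ?_
  exact (metricCoord_coord g hp _ _).symm

/-- The covariant derivative at `t` in the preferred chart around `x t`. -/
lemma fieldCoord_covDeriv_self (ht : t₀ < t₁) {t : ℝ} (hts : t ∈ Icc t₀ t₁)
    (hx : ContMDiffWithinAt 𝓘(ℝ, ℝ) (𝓡 m) 1 x (Icc t₀ t₁) t) (T : Set ℝ)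
    (V : (t : ℝ) → TangentSpace (𝓡 m) (x t)) :
    fieldCoord (x t) x (covDeriv g t₀ t₁ x T V) t =
      derivWithin (fieldCoord (x t) x V) T t + Gam g (x t) (curveCoord (m := m) (x t) x t)
        (derivWithin (curveCoord (m := m) (x t) x) (Icc t₀ t₁) t) (fieldCoord (x t) x V t) := by
  have hq := mem_extChartAt_source (I := 𝓡 m) (x t)
  rw [fieldCoord, covDeriv, coord_ofCoord hq, coord_velocity ht hts hx hq]
  rfl

set_option synthInstance.maxHeartbeats 200000 in
/-- The covariant derivative is compatible with the metric. -/
lemma hasDerivWithinAt_inner (ht : t₀ < t₁) {t : ℝ} (hts : t ∈ Icc t₀ t₁) {T : Set ℝ}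
    (hT : T ⊆ Icc t₀ t₁)
    {V Z : (t : ℝ) → TangentSpace (𝓡 m) (x t)}
    (hx : ContMDiffWithinAt 𝓘(ℝ, ℝ) (𝓡 m) 1 x (Icc t₀ t₁) t)
    (hV : DifferentiableWithinAt ℝ (fieldCoord (x t) x V) T t)
    (hZ : DifferentiableWithinAt ℝ (fieldCoord (x t) x Z) T t) :
    HasDerivWithinAt (fun s => g.inner (x s) (V s) (Z s))
      (g.inner (x t) (covDeriv g t₀ t₁ x T V t) (Z t)
        + g.inner (x t) (V t) (covDeriv g t₀ t₁ x T Z t)) T t := by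
  have hq := mem_extChartAt_source (I := 𝓡 m) (x t)
  have hut : curveCoord (x t) x t ∈ (extChartAt (𝓡 m) (x t)).target :=
    (extChartAt (𝓡 m) (x t)).map_source hq
  have hu := ((contDiffWithinAt_curveCoord (n := 1) hx hq).differentiableWithinAt
    (by norm_num)).hasDerivWithinAt.mono hT
  have hG : HasDerivWithinAt (fun s => metricCoord g (x t) (curveCoord (x t) x s)) _ T t :=
    ((contDiffAt_metricCoord g hut).differentiableAt
    (by simp)).hasFDerivAt.comp_hasDerivWithinAt t hu
  have h1 := (HasDerivWithinAt.bilin_apply hG hV.hasDerivWithinAt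
    hZ.hasDerivWithinAt).congr_of_eventuallyEq
    (inner_eventuallyEq_metricCoord g (hx.continuousWithinAt.mono hT) hq V Z)
    (metricCoord_coord g hq _ _).symm
  refine h1.congr_deriv ?_
  -- By compatibility the derivative of the metric along the curve splits into the two Γ terms that
  -- complete V' and Z' to covariant derivatives.
  rw [← metricCoord_coord g hq, ← metricCoord_coord g hq, ← dmetric_eq g hut,
    dmetric_eq_Gam g hut]
  change _ = metricCoord g (x t) (curveCoord (x t) x t)
      (fieldCoord (x t) x (covDeriv g t₀ t₁ x T V) t) (fieldCoord (x t) x Z t) +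
    metricCoord g (x t) (curveCoord (x t) x t)
      (fieldCoord (x t) x V t) (fieldCoord (x t) x (covDeriv g t₀ t₁ x T Z) t)
  rw [fieldCoord_covDeriv_self g ht hts hx, fieldCoord_covDeriv_self g ht hts hx]
  simp only [map_add, _root_.add_apply]
  ring

lemma covDeriv_subset {t : ℝ} {T : Set ℝ} (hT : T ⊆ Icc t₀ t₁) (hTt : UniqueDiffWithinAt ℝ T t)
    {V : (t : ℝ) → TangentSpace (𝓡 m) (x t)}
    (hV : DifferentiableWithinAt ℝ (fieldCoord (x t) x V) (Icc t₀ t₁) t) :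
    covDeriv g t₀ t₁ x T V t = covDeriv g t₀ t₁ x (Icc t₀ t₁) V t := by
  have h := derivWithin_subset hT hTt hV
  simp only [covDeriv]
  congr 2

lemma IsPiecewiseC2.right {F : Type*} [NormedAddCommGroup F] [NormedSpace ℝ F] {H : Type*}
    [TopologicalSpace H] {I : ModelWithCorners ℝ F H} {N : Type*} [TopologicalSpace N]
    [ChartedSpace H N] {f : ℝ → N} (hf : IsPiecewiseC2 I t₀ t₁ f) {t : ℝ} (ht : t ∈ Ico t₀ t₁) :
    ContMDiffWithinAt 𝓘(ℝ, ℝ) I 2 f (Icc t t₁) t := by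
  obtain ⟨P, hP⟩ := hf.2
  have h1 : ∀ᶠ b in 𝓝[>] t, Disjoint (Ioo t b) (P : Set ℝ) := by
    -- The point t may itself be a break point; this is harmless, since it is not interior to [t,
    -- b].
    have h2 : ((P : Set ℝ) \ {t})ᶜ ∈ 𝓝 t :=
      (P.finite_toSet.subset sdiff_subset).isClosed.isOpen_compl.mem_nhds (by simp)
    obtain ⟨b, hb, hbs⟩ := (mem_nhdsGT_iff_exists_Ioo_subset).1 (mem_nhdsWithin_of_mem_nhds h2)
    filter_upwards [Ioo_mem_nhdsGT hb] with c hc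
    rw [Set.disjoint_left]
    intro r hr hrP
    exact hbs ⟨hr.1, hr.2.trans hc.2⟩ ⟨hrP, hr.1.ne'⟩
  obtain ⟨b, hb, hbt⟩ := (h1.and (Ioo_mem_nhdsGT ht.2)).exists
  refine (hP t b hbt.1 (Icc_subset_Icc ht.1 hbt.2.le) hb t
    (left_mem_Icc.2 hbt.1.le)).mono_of_mem_nhdsWithin ?_
  rw [nhdsWithin_Icc_eq_nhdsGE ht.2]
  exact Icc_mem_nhdsGE hbt.1

/-- First derivatives are taken within all of [t₀, t₁], but C² regularity is available only on one
side of a break point. On T both derivatives agree. -/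
lemma contDiffWithinAt_derivWithin_of_subset {V : Type*} [NormedAddCommGroup V] [NormedSpace ℝ V]
    {f : ℝ → V} {S T : Set ℝ} {t : ℝ} (hTS : T ⊆ S) (hT : UniqueDiffOn ℝ T) (ht : t ∈ T)
    (hf : ContDiffWithinAt ℝ 2 f T t) (hfS : ∀ᶠ s in 𝓝[S] t, DifferentiableWithinAt ℝ f S s) :
    ContDiffWithinAt ℝ 1 (derivWithin f S) T t := by
  have h1 : ContDiffWithinAt ℝ 1 (derivWithin f T) T t :=
    hf.derivWithin hT (by norm_num) ht
  have h2 : derivWithin f S =ᶠ[𝓝[T] t] derivWithin f T := by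
    filter_upwards [nhdsWithin_mono t hTS hfS, self_mem_nhdsWithin] with s hs hsT
    exact (derivWithin_subset hTS (hT s hsT) hs).symm
  exact h1.congr_of_eventuallyEq h2 (h2.self_of_nhdsWithin ht)

lemma IsPiecewiseC2Field.differentiableWithinAt {V : (t : ℝ) → TangentSpace (𝓡 m) (x t)}
    (hV : IsPiecewiseC2Field t₀ t₁ x V) {p : M} {s : ℝ} (hs : s ∈ Icc t₀ t₁)
    (hp : x s ∈ (extChartAt (𝓡 m) p).source) :
    DifferentiableWithinAt ℝ (fieldCoord p x V) (Icc t₀ t₁) s :=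
  (contDiffWithinAt_fieldCoord (n := 1) (hV.1 s hs) hp).differentiableWithinAt (by norm_num)

lemma IsPiecewiseC2Field.fieldCoord_covDeriv_eventuallyEq (ht : t₀ < t₁)
    {V : (t : ℝ) → TangentSpace (𝓡 m) (x t)} (hV : IsPiecewiseC2Field t₀ t₁ x V) {p : M} {t : ℝ}
    (hts : t ∈ Icc t₀ t₁) (hp : x t ∈ (extChartAt (𝓡 m) p).source) :
    fieldCoord p x (covDeriv g t₀ t₁ x (Icc t₀ t₁) V) =ᶠ[𝓝[Icc t₀ t₁] t] fun s =>
      derivWithin (fieldCoord p x V) (Icc t₀ t₁) s + Gam g p (curveCoord (m := m) p x s)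
        (derivWithin (curveCoord (m := m) p x) (Icc t₀ t₁) s) (fieldCoord p x V s) := by
  have hx := contMDiffWithinAt_base (n := 1) (hV.1 t hts)
  filter_upwards [eventually_mem_source hx.continuousWithinAt hp, self_mem_nhdsWithin] with s hs hsI
  exact fieldCoord_covDeriv g ht hsI (hV.1 s hsI) hs

lemma IsPiecewiseC2Field.continuousWithinAt_covDeriv (ht : t₀ < t₁)
    {V : (t : ℝ) → TangentSpace (𝓡 m) (x t)} (hV : IsPiecewiseC2Field t₀ t₁ x V) {p : M} {t : ℝ}
    (hts : t ∈ Icc t₀ t₁) (hp : x t ∈ (extChartAt (𝓡 m) p).source) :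
    ContinuousWithinAt (fieldCoord p x (covDeriv g t₀ t₁ x (Icc t₀ t₁) V)) (Icc t₀ t₁) t := by
  have hu := contDiffWithinAt_curveCoord (n := 1) (contMDiffWithinAt_base (n := 1) (hV.1 t hts)) hp
  have hv := contDiffWithinAt_fieldCoord (n := 1) (hV.1 t hts) hp
  have hu' : ContDiffWithinAt ℝ (0 : ℕ) _ _ _ :=
    hu.derivWithin (uniqueDiffOn_Icc ht) (by norm_num) hts
  have hv' : ContDiffWithinAt ℝ (0 : ℕ) _ _ _ :=
    hv.derivWithin (uniqueDiffOn_Icc ht) (by norm_num) hts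
  have h := hv'.add (contDiffWithinAt_Gam g ((extChartAt (𝓡 m) p).map_source hp)
    (hu.of_le (by norm_num)) hu' (hv.of_le (by norm_num)))
  have hev := hV.fieldCoord_covDeriv_eventuallyEq g ht hts hp
  exact h.continuousWithinAt.congr_of_eventuallyEq hev (hev.self_of_nhdsWithin hts)

lemma IsPiecewiseC2Field.differentiableWithinAt_covDeriv (ht : t₀ < t₁)
    {V : (t : ℝ) → TangentSpace (𝓡 m) (x t)} (hV : IsPiecewiseC2Field t₀ t₁ x V) {p : M} {t : ℝ}
    (hts : t ∈ Ico t₀ t₁) (hp : x t ∈ (extChartAt (𝓡 m) p).source) :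
    DifferentiableWithinAt ℝ (fieldCoord p x (covDeriv g t₀ t₁ x (Icc t₀ t₁) V)) (Icc t t₁) t := by
  have hI : t ∈ Icc t₀ t₁ := Ico_subset_Icc_self hts
  have hsub : Icc t t₁ ⊆ Icc t₀ t₁ := Icc_subset_Icc_left hts.1
  have hmem : t ∈ Icc t t₁ := left_mem_Icc.2 hts.2.le
  have hx := contMDiffWithinAt_base (n := 1) (hV.1 t hI)
  have hR : ContMDiffWithinAt 𝓘(ℝ, ℝ) (𝓡 m).tangent (2 : ℕ)
    (fun t => (⟨x t, V t⟩ : TangentBundle (𝓡 m) M)) (Icc t t₁) t := IsPiecewiseC2.right hV hts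
  have hu := contDiffWithinAt_curveCoord (contMDiffWithinAt_base hR) hp
  have hv := contDiffWithinAt_fieldCoord hR hp
  have hev := hV.fieldCoord_covDeriv_eventuallyEq g ht hI hp
  have hsrc := (eventually_mem_source hx.continuousWithinAt hp).and self_mem_nhdsWithin
  have hu' : ContDiffWithinAt ℝ (1 : ℕ) _ _ _ :=
    contDiffWithinAt_derivWithin_of_subset hsub (uniqueDiffOn_Icc hts.2) hmem hu
    (hsrc.mono fun s hs => (contDiffWithinAt_curveCoord (n := 1)
      (contMDiffWithinAt_base (n := 1) (hV.1 s hs.2)) hs.1).differentiableWithinAt (by norm_num))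
  have hv' : ContDiffWithinAt ℝ (1 : ℕ) _ _ _ :=
    contDiffWithinAt_derivWithin_of_subset hsub (uniqueDiffOn_Icc hts.2) hmem hv
    (hsrc.mono fun s hs => hV.differentiableWithinAt hs.2 hs.1)
  have h := hv'.add (contDiffWithinAt_Gam g ((extChartAt (𝓡 m) p).map_source hp)
    (hu.of_le (by norm_num)) hu' (hv.of_le (by norm_num)))
  have hev' := hev.filter_mono (nhdsWithin_mono t hsub)
  exact (h.congr_of_eventuallyEq hev' (hev'.self_of_nhdsWithin hmem)).differentiableWithinAt
    (by norm_num)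

/-- Green's identity for the operator `L`, in differentiated form. -/
lemma hasDerivWithinAt_green (ht : t₀ < t₁) {W X : (t : ℝ) → TangentSpace (𝓡 m) (x t)}
    (hW : IsPiecewiseC2Field t₀ t₁ x W) (hX : IsPiecewiseC2Field t₀ t₁ x X) {t : ℝ}
    (hts : t ∈ Ico t₀ t₁) :
    HasDerivWithinAt (fun s => g.inner (x s) (covDeriv g t₀ t₁ x (Icc t₀ t₁) W s) (X s)
        - g.inner (x s) (W s) (covDeriv g t₀ t₁ x (Icc t₀ t₁) X s))
      (g.inner (x t) (opL g t₀ t₁ x W .right t) (X t)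
        - g.inner (x t) (W t) (opL g t₀ t₁ x X .right t)) (Icc t t₁) t := by
  have hI : t ∈ Icc t₀ t₁ := Ico_subset_Icc_self hts
  have hsub : Icc t t₁ ⊆ Icc t₀ t₁ := Icc_subset_Icc_left hts.1
  have hu : UniqueDiffWithinAt ℝ (Icc t t₁) t :=
    uniqueDiffOn_Icc hts.2 t (left_mem_Icc.2 hts.2.le)
  have hq := mem_extChartAt_source (I := 𝓡 m) (x t)
  have hx := contMDiffWithinAt_base (n := 1) (hW.1 t hI)
  have hWd := hW.differentiableWithinAt hI hq
  have hXd := hX.differentiableWithinAt hI hq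
  have h1 := hasDerivWithinAt_inner g ht hI hsub hx
    (hW.differentiableWithinAt_covDeriv g ht hts hq) (hXd.mono hsub)
  have h2 := hasDerivWithinAt_inner g ht hI hsub hx (hWd.mono hsub)
    (hX.differentiableWithinAt_covDeriv g ht hts hq)
  refine (h1.sub h2).congr_deriv ?_
  -- W and X are C¹, so their one-sided first derivatives are the full ones, and the ⟨∇ₜW, ∇ₜX⟩
  -- terms cancel.
  rw [covDeriv_subset g hsub hu hWd, covDeriv_subset g hsub hu hXd]
  have hcurv : g.inner (x t) (curv g (x t) (W t) (velocity t₀ t₁ x t) (velocity t₀ t₁ x t)) (X t) =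
      g.inner (x t) (W t) (curv g (x t) (X t) (velocity t₀ t₁ x t) (velocity t₀ t₁ x t)) := by
    rw [← metricCoord_coord g hq, ← metricCoord_coord g hq, curv, curv, coord_ofCoord hq,
      coord_ofCoord hq]
    exact curvCoord_jacobi_symm g ((extChartAt (𝓡 m) (x t)).map_source hq) _ _ _
  simp only [opL, map_add, _root_.add_apply, Side.interval]
  rw [hcurv]
  ring

lemma continuousOn_green (ht : t₀ < t₁) {W X : (t : ℝ) → TangentSpace (𝓡 m) (x t)}
    (hW : IsPiecewiseC2Field t₀ t₁ x W) (hX : IsPiecewiseC2Field t₀ t₁ x X) :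
    ContinuousOn (fun s => g.inner (x s) (covDeriv g t₀ t₁ x (Icc t₀ t₁) W s) (X s)
        - g.inner (x s) (W s) (covDeriv g t₀ t₁ x (Icc t₀ t₁) X s)) (Icc t₀ t₁) := by
  intro t hI
  have hq := mem_extChartAt_source (I := 𝓡 m) (x t)
  have hx := contMDiffWithinAt_base (n := 1) (hW.1 t hI)
  exact (continuousWithinAt_inner g hx hq (hW.continuousWithinAt_covDeriv g ht hI hq)
    (hX.differentiableWithinAt hI hq).continuousWithinAt).sub
    (continuousWithinAt_inner g hx hq (hW.differentiableWithinAt hI hq).continuousWithinAt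
      (hX.continuousWithinAt_covDeriv g ht hI hq))

/-- A continuous function with nonpositive right derivative and equal values at the end points
has zero right derivative everywhere. -/
lemma right_deriv_eq_zero {F d : ℝ → ℝ} (hF : ContinuousOn F (Icc t₀ t₁))
    (hd : ∀ t ∈ Ico t₀ t₁, HasDerivWithinAt F (d t) (Icc t t₁) t) (hd0 : ∀ t ∈ Ico t₀ t₁, d t ≤ 0)
    (h01 : F t₀ = F t₁) {t : ℝ} (ht : t ∈ Ico t₀ t₁) : d t = 0 := by
  -- The mean value inequality for right derivatives, with the constant F a as upper barrier on [a,
  -- t₁].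
  have hanti : ∀ a ∈ Icc t₀ t₁, ∀ b ∈ Icc a t₁, F b ≤ F a := fun a ha b hb =>
    image_le_of_deriv_right_le_deriv_boundary (f' := d) (B := fun _ => F a) (B' := fun _ => 0)
      (hF.mono (Icc_subset_Icc_left ha.1))
      (fun s hs => (hd s ⟨ha.1.trans hs.1, hs.2⟩).mono_of_mem_nhdsWithin (Icc_mem_nhdsGE hs.2))
      le_rfl continuousOn_const (fun s _ => hasDerivWithinAt_const s _ _)
      (fun s hs => hd0 s ⟨ha.1.trans hs.1, hs.2⟩) hb
  have hle : t₀ ≤ t₁ := ht.1.trans ht.2.le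
  have hconst : ∀ s ∈ Icc t₀ t₁, F s = F t₁ := fun s hs =>
    le_antisymm ((hanti t₀ (left_mem_Icc.2 hle) s hs).trans_eq h01)
      (hanti s hs t₁ (right_mem_Icc.2 hs.2))
  have hmem := left_mem_Icc.2 ht.2.le
  have h1 : HasDerivWithinAt F 0 (Icc t t₁) t :=
    (hasDerivWithinAt_const t (Icc t t₁) (F t₁)).congr
      (fun s hs => hconst s (Icc_subset_Icc_left ht.1 hs))
      (hconst t (Icc_subset_Icc_left ht.1 hmem))
  exact (uniqueDiffOn_Icc ht.2 t hmem).eq_deriv _ (hd t ht) h1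

/-- Otherwise t₀ would be a zero of Φ that is a limit of other zeros. The end t₁ is excluded because
right derivatives are used. -/
lemma exists_ne_zero_of_discrete (ht : t₀ < t₁) {Φ : ℝ → ℝ}
    (hΦ : DiscreteTopology {t : ℝ // t ∈ Icc t₀ t₁ ∧ Φ t = 0}) : ∃ t ∈ Ico t₀ t₁, Φ t ≠ 0 := by
  by_contra! h
  have h1 := discreteTopology_subtype_iff.1 hΦ t₀
    ⟨left_mem_Icc.2 ht.le, h t₀ (left_mem_Ico.2 ht)⟩
  have h2 : 𝓝[>] t₀ ≤ 𝓝[≠] t₀ ⊓ 𝓟 {t | t ∈ Icc t₀ t₁ ∧ Φ t = 0} := by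
    refine le_inf (nhdsWithin_mono _ fun s hs => ne_of_gt hs) (le_principal_iff.2 ?_)
    filter_upwards [Ioo_mem_nhdsGT ht] with s hs
    exact ⟨Ioo_subset_Icc_self hs, h s (Ioo_subset_Ico_self hs)⟩
  exact (inferInstance : (𝓝[>] t₀).NeBot).ne (le_bot_iff.1 (h2.trans_eq h1))

lemma J_eq_of_constant (ht : t₀ < t₁) {z : ℝ}
    (hz : ∀ (t : ℝ) (σ : Side), σ.Admissible t₀ t₁ t →
      rnorm g (x t) (accel g t₀ t₁ x σ t) = z) : J g t₀ t₁ x = z := by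
  have h : {r : ℝ | ∃ (t : ℝ) (σ : Side), σ.Admissible t₀ t₁ t ∧
      r = rnorm g (x t) (accel g t₀ t₁ x σ t)} = {z} := by
    ext r
    constructor
    · rintro ⟨t, σ, hσ, rfl⟩
      exact hz t σ hσ
    · rintro rfl
      have hσ : Side.right.Admissible t₀ t₁ t₀ := ⟨left_mem_Icc.2 ht.le, ht⟩
      exact ⟨t₀, .right, hσ, (hz t₀ .right hσ).symm⟩
  rw [J, h, csSup_singleton]

end Extremal

end MinAccel

end

theorem proposition1 {m : ℕ} {M : Type*} [TopologicalSpace M]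
    [ChartedSpace (EuclideanSpace ℝ (Fin m)) M] [IsManifold (𝓡 m) ∞ M]
    (g : MinAccel.Metric m M) (t₀ t₁ : ℝ) (ht : t₀ < t₁)
    (x₀ x₁ : M) (v₀ : TangentSpace (𝓡 m) x₀) (v₁ : TangentSpace (𝓡 m) x₁)
    (x : ℝ → M) (hx : MinAccel.IsFeasible t₀ t₁ x v₀ v₁)
    (hN : MinAccel.NecessaryCondition g t₀ t₁ x) :
    MinAccel.IsLinftyExtremal g t₀ t₁ x := by
  open MinAccel in
  intro W hW
  obtain ⟨⟨z, hz⟩, Φ, -, hΦ0, hdisc, ⟨X, hX, hXL⟩, -⟩ := hN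
  by_contra! hneg
  have hadm : ∀ t ∈ Set.Ico t₀ t₁, Side.right.Admissible t₀ t₁ t := fun t hts =>
    ⟨Set.Ico_subset_Icc_self hts, hts.2⟩
  have hlt : ∀ t ∈ Set.Ico t₀ t₁,
      g.inner (x t) (opL g t₀ t₁ x W .right t) (accel g t₀ t₁ x .right t) < 0 := fun t hts =>
    hneg t .right (hadm t hts) ((hz t _ (hadm t hts)).trans (J_eq_of_constant g ht hz).symm)
  have hd : ∀ t ∈ Set.Ico t₀ t₁, g.inner (x t) (opL g t₀ t₁ x W .right t) (X t)
      - g.inner (x t) (W t) (opL g t₀ t₁ x X .right t) =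
      √(Φ t) * g.inner (x t) (opL g t₀ t₁ x W .right t) (accel g t₀ t₁ x .right t) := by
    intro t hts
    obtain ⟨h1, h2⟩ := hXL t .right (hadm t hts)
    rw [h1, h2, map_zero, sub_zero, map_smul, smul_eq_mul]
  obtain ⟨t, hts, hΦt⟩ := exists_ne_zero_of_discrete ht hdisc
  have h0 := right_deriv_eq_zero (continuousOn_green g ht hW.piecewiseC2 hX)
    (fun t hts => hasDerivWithinAt_green g ht hW.piecewiseC2 hX hts)
    (fun t hts => by
      rw [hd t hts]
      exact mul_nonpos_of_nonneg_of_nonpos (Real.sqrt_nonneg _) (hlt t hts).le)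
    -- Both boundary terms vanish, since W and ∇ₜW are zero at the end points.
    (by simp [hW.init, hW.final, hW.init_deriv, hW.final_deriv]) hts
  rw [hd t hts] at h0
  have hpos : 0 < √(Φ t) :=
    Real.sqrt_pos.2 ((hΦ0 t (Set.Ico_subset_Icc_self hts)).lt_of_ne hΦt.symm)
  exact (mul_neg_of_pos_of_neg hpos (hlt t hts)).ne h0
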